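/- Let $G$ be a (finite-dimensional, second countable, Hausdorff) Lie group with Lie algebra $\mathfrak g$, acting smoothly and properly on a smooth (finite-dimensional, Hausdorff, paracompact) manifold $M$ with a symplectic form $\omega$ that the action preserves. Let $F\colon M\to\mathfrak g^*$ be an equivariant momentum map: $F$ is smooth, $d\langle F,\xi\rangle=\omega(\xi_M,\cdot)$ for all $\xi\in\mathfrak g$, where $\xi_M$ is the vector field on $M$ induced by $\xi$, and $F(g\cdot m)=g\cdot F(m)$, where $G$ acts on $\mathfrak g^*$ by the coadjoint action $\langle g\cdot\beta,\xi\rangle=\langle\beta,\mathrm{Ad}(g^{-1})\xi\rangle$. Let $x\in M$ and $\alpha=F(x)$, let $G_x\subseteq G_\alpha$ be the isotropy groups of $x$ and of $\alpha$, and let $\mathfrak g_x\subseteq\mathfrak g_\alpha$ be their Lie algebras. Choose $G_x$-invariant splittings $$\mathfrak g=\mathfrak g_\alpha\oplus\mathfrak s,\qquad \mathfrak g_\alpha=\mathfrak g_x\oplus\mathfrak m,\qquad T_x(G\cdot x)^{\omega}=\{\xi_M(x):\xi\in\mathfrak g_\alpha\}\oplus V,$$ where $T_x(G\cdot x)^{\omega}\subseteq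 T_xM$ is the symplectic perpendicular of the tangent space of the orbit. Let $i\colon\mathfrak g_x^*\to\mathfrak g^*$ be the transpose of the projection $\mathfrak g\to\mathfrak g_x$ along $\mathfrak m\oplus\mathfrak s$, and let $j\colon(\mathfrak g_\alpha/\mathfrak g_x)^*\to\mathfrak g^*$ be the transpose of the composition of the projection $\mathfrak g\to\mathfrak g_\alpha$ along $\mathfrak s$ with $\mathfrak g_\alpha\to\mathfrak g_\alpha/\mathfrak g_x$. Let $F_V\colon V\to\mathfrak g_x^*$, $\langle F_V(v),\xi\rangle=\tfrac12\,\omega_x(\xi\cdot v,v)$, be the quadratic momentum map of the linear symplectic action of $G_x$ on $V$. Let $$Y=G\times_{G_x}\big((\mathfrak g_\alpha/\mathfrak g_x)^*\times V\big)$$ be the quotient of $G\times(\mathfrak g_\alpha/\mathfrak g_x)^*\times V$ by the action $h\cdot(g,\lambda,v)=(gh^{-1},h\cdot\lambda,h\cdot v)$ of $G_x$, write $[g,\lambda,v]$ for the class of $(g,\lambda,v)$, and let $$F_Y\colon Y\to\mathfrak g^*,\qquad F_Y([g,\lambda,v])=g\cdot\big(\alpha+j(\lambda)+i(F_V(v))\big).$$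 Assume that the coadjoint orbit $G\cdot\alpha$ is locally closed in $\mathfrak g^*$. Then there is an open neighbourhood $Y_0\subseteq Y$ of the zero section $\{[g,0,0]:g\in G\}$ (which is a copy of the orbit $G\cdot x$) such that $$F_Y^{-1}(G\cdot\alpha)\cap Y_0=\{[g,\lambda,v]\in Y_0:\ \lambda=0\ \text{ and }\ F_V(v)=0\}.$$ -/

import Mathlib

open scoped Manifold ContDiff

set_option linter.unusedSectionVars false

namespace HamiltonianModel

/-! ### Tangent maps

All manifolds are real, smooth, finite-dimensional, without boundary, and modelled on a normed
space `E` through `𝓘(ℝ, E)`. Mathlib's tangent space `TangentSpace 𝓘(ℝ, E) m` *is* (by definition)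
the model space `E`, for every `m`. We use `E` itself in place of `TangentSpace 𝓘(ℝ, E) m`, since
it carries a norm. Likewise the Lie algebra `GroupLieAlgebra 𝓘(ℝ, 𝔤) G = T_1 G` of a Lie group `G`
modelled on `𝔤` is by definition `𝔤`. -/

section Tangent

variable (E : Type*) [NormedAddCommGroup E] [NormedSpace ℝ E]
  {M : Type*} [TopologicalSpace M] [ChartedSpace E M]
  (E' : Type*) [NormedAddCommGroup E'] [NormedSpace ℝ E']
  {M' : Type*} [TopologicalSpace M'] [ChartedSpace E' M']

/-- The tangent map `T_m M → T_{f m} M'` of `f : M → M'` at `m`. -/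
noncomputable def tmap (f : M → M') (m : M) : E →L[ℝ] E' :=
  (mfderiv 𝓘(ℝ, E) 𝓘(ℝ, E') f m : TangentSpace 𝓘(ℝ, E) m →L[ℝ] TangentSpace 𝓘(ℝ, E') (f m))

/-- Differentiability at a point of a map between manifolds. -/
def DiffAt (f : M → M') (m : M) : Prop := MDifferentiableAt 𝓘(ℝ, E) 𝓘(ℝ, E') f m

variable {E E'} {E'' : Type*} [NormedAddCommGroup E''] [NormedSpace ℝ E'']
  {M'' : Type*} [TopologicalSpace M''] [ChartedSpace E'' M'']

theorem tmap_comp {g : M' → M''} {f : M → M'} {m : M} {n : M'} (hn : f m = n)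
    (hg : DiffAt E' E'' g n) (hf : DiffAt E E' f m) :
    tmap E E'' (g ∘ f) m = (tmap E' E'' g n).comp (tmap E E' f m) := by
  subst hn
  exact mfderiv_comp m hg hf

theorem tmap_comp_apply {g : M' → M''} {f : M → M'} {m : M} {n : M'} (hn : f m = n)
    (hg : DiffAt E' E'' g n) (hf : DiffAt E E' f m) (v : E) :
    tmap E E'' (fun p => g (f p)) m v = tmap E' E'' g n (tmap E E' f m v) :=
  congrArg (fun L : E →L[ℝ] E'' => L v) (tmap_comp hn hg hf)

theorem DiffAt.comp {g : M' → M''} {f : M → M'} {m : M} {n : M'} (hn : f m = n)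
    (hg : DiffAt E' E'' g n) (hf : DiffAt E E' f m) : DiffAt E E'' (fun p => g (f p)) m := by
  subst hn
  exact MDifferentiableAt.comp m hg hf

theorem tmap_id (m : M) : tmap E E (id : M → M) m = ContinuousLinearMap.id ℝ E :=
  mfderiv_id (I := 𝓘(ℝ, E))

theorem tmap_const (c : M') (m : M) : tmap E E' (fun _ : M => c) m = 0 :=
  mfderiv_const (I := 𝓘(ℝ, E)) (I' := 𝓘(ℝ, E'))

theorem tmap_extChartAt_self [IsManifold 𝓘(ℝ, E) ∞ M] (x : M) :
    tmap E E (extChartAt 𝓘(ℝ, E) x) x = ContinuousLinearMap.id ℝ E := by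
  have h1 : mfderiv 𝓘(ℝ, E) 𝓘(ℝ, E) (extChartAt 𝓘(ℝ, E) x) x
      = (mfderiv 𝓘(ℝ, E) 𝓘(ℝ, E) (chartAt E x) x) :=
    (hasMFDerivAt_extChartAt (I := 𝓘(ℝ, E)) (mem_chart_source E x)).mfderiv
  have h2 := mfderiv_chartAt_eq_tangentCoordChange (I := 𝓘(ℝ, E)) (mem_chart_source E x)
  ext v
  have h3 := tangentCoordChange_self (I := 𝓘(ℝ, E)) (x := x) (z := x) (v := v)
    (mem_extChartAt_source x)
  rw [tmap, h1, h2]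
  exact h3

end Tangent

/-! ### Adjoint and coadjoint action, Lie algebra of a closed subgroup -/

section Group

variable {𝔤 : Type*} [NormedAddCommGroup 𝔤] [NormedSpace ℝ 𝔤]
  {G : Type*} [TopologicalSpace G] [ChartedSpace 𝔤 G] [Group G]

variable (𝔤) in
/-- The adjoint action of `g` on the Lie algebra: the derivative at `1` of `h ↦ g h g⁻¹`. -/
noncomputable def Ad (g : G) : 𝔤 →L[ℝ] 𝔤 := tmap 𝔤 𝔤 (fun h : G => g * h * g⁻¹) 1

/-- The coadjoint action: `⟨g · α, ξ⟩ = ⟨α, Ad(g⁻¹) ξ⟩`. -/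
noncomputable def coAd (g : G) (α : StrongDual ℝ 𝔤) : StrongDual ℝ 𝔤 := α.comp (Ad 𝔤 g⁻¹)

variable (G) in
/-- The coadjoint orbit `G · α`. -/
def coadjointOrbit (α : StrongDual ℝ 𝔤) : Set (StrongDual ℝ 𝔤) :=
  Set.range fun g : G => coAd g α

section
variable [LieGroup 𝓘(ℝ, 𝔤) ∞ G]

theorem diffAt_conj (g h : G) : DiffAt 𝔤 𝔤 (fun k : G => g * k * g⁻¹) h := by
  have h1 : ContMDiff 𝓘(ℝ, 𝔤) 𝓘(ℝ, 𝔤) ∞ (fun k : G => g * k * g⁻¹) :=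
    (contMDiff_const.mul contMDiff_id).mul contMDiff_const
  exact h1.contMDiffAt.mdifferentiableAt (by simp)

theorem Ad_one : Ad 𝔤 (1 : G) = ContinuousLinearMap.id ℝ 𝔤 := by
  have : (fun h : G => 1 * h * (1 : G)⁻¹) = id := by ext; simp
  rw [Ad, this, tmap_id]

theorem Ad_mul (g h : G) : Ad 𝔤 (g * h) = (Ad 𝔤 g).comp (Ad 𝔤 h) := by
  have : (fun k : G => g * h * k * (g * h)⁻¹)
      = (fun k : G => g * k * g⁻¹) ∘ (fun k : G => h * k * h⁻¹) := by
    ext; simp [mul_assoc]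
  rw [Ad, this, tmap_comp (n := 1) (by simp) (diffAt_conj _ _) (diffAt_conj _ _)]
  rfl

theorem Ad_inv_apply_Ad (g : G) (ξ : 𝔤) : Ad 𝔤 g⁻¹ (Ad 𝔤 g ξ) = ξ := by
  have := Ad_mul (𝔤 := 𝔤) g⁻¹ g
  rw [inv_mul_cancel, Ad_one] at this
  exact (congrArg (fun f : 𝔤 →L[ℝ] 𝔤 => f ξ) this).symm

theorem Ad_apply_Ad_inv (g : G) (ξ : 𝔤) : Ad 𝔤 g (Ad 𝔤 g⁻¹ ξ) = ξ := by
  simpa using Ad_inv_apply_Ad g⁻¹ ξ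

theorem coAd_one (α : StrongDual ℝ 𝔤) : coAd (1 : G) α = α := by
  rw [coAd, inv_one, Ad_one, ContinuousLinearMap.comp_id]

theorem coAd_mul (g h : G) (α : StrongDual ℝ 𝔤) : coAd (g * h) α = coAd g (coAd h α) := by
  simp only [coAd, mul_inv_rev, Ad_mul, ContinuousLinearMap.comp_assoc]

variable (G) in
/-- The isotropy group `G_α` of `α` for the coadjoint action. -/
def coadjointStabilizer (α : StrongDual ℝ 𝔤) : Subgroup G where
  carrier := {g | coAd g α = α}
  one_mem' := coAd_one α
  mul_mem' := by
    intro g h hg hh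
    simp only [Set.mem_ofPred_eq] at *
    rw [coAd_mul, hh, hg]
  inv_mem' := by
    intro g hg
    simp only [Set.mem_ofPred_eq] at *
    conv_lhs => rw [← hg]
    rw [← coAd_mul, inv_mul_cancel, coAd_one]

/-- `ξ` is the velocity at `0` of a curve through `1` in the subgroup `H`. -/
def IsVelocity (H : Subgroup G) (γ : ℝ → G) (ξ : 𝔤) : Prop :=
  γ 0 = 1 ∧ (∀ t, γ t ∈ H) ∧ DiffAt ℝ 𝔤 γ 0 ∧ tmap ℝ 𝔤 γ 0 1 = ξ

theorem tmap_mul_curve {γ δ : ℝ → G} (hγ0 : γ 0 = 1) (hδ0 : δ 0 = 1)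
    (hγ : DiffAt ℝ 𝔤 γ 0) (hδ : DiffAt ℝ 𝔤 δ 0) :
    DiffAt ℝ 𝔤 (fun t => γ t * δ t) 0 ∧
      tmap ℝ 𝔤 (fun t => γ t * δ t) 0 1 = tmap ℝ 𝔤 γ 0 1 + tmap ℝ 𝔤 δ 0 1 := by
  have hm : MDifferentiableAt (𝓘(ℝ, 𝔤).prod 𝓘(ℝ, 𝔤)) 𝓘(ℝ, 𝔤) (fun p : G × G => p.1 * p.2)
      (γ 0, δ 0) := (contMDiff_mul 𝓘(ℝ, 𝔤) ∞).contMDiffAt.mdifferentiableAt (by simp)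
  have hp := MDifferentiableAt.prodMk hγ hδ
  have hc : MDifferentiableAt 𝓘(ℝ, ℝ) 𝓘(ℝ, 𝔤)
      ((fun p : G × G => p.1 * p.2) ∘ fun t => (γ t, δ t)) 0 := MDifferentiableAt.comp (0 : ℝ) hm hp
  refine ⟨hc, ?_⟩
  have h1 := mfderiv_comp_apply (0 : ℝ) hm hp (1 : ℝ)
  have h2 := MDifferentiableAt.mfderiv_prod hγ hδ
  rw [h2, mfderiv_prod_eq_add_apply hm] at h1
  refine h1.trans ?_
  have e1 : (fun z : G => z * δ 0) = id := by ext; simp [hδ0]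
  have e2 : (fun z : G => γ 0 * z) = id := by ext; simp [hγ0]
  have e3 : tmap 𝔤 𝔤 (fun z : G => z * δ 0) (γ 0) = ContinuousLinearMap.id ℝ 𝔤 := by
    rw [e1, tmap_id]
  have e4 : tmap 𝔤 𝔤 (fun z : G => γ 0 * z) (δ 0) = ContinuousLinearMap.id ℝ 𝔤 := by
    rw [e2, tmap_id]
  change tmap 𝔤 𝔤 (fun z : G => z * δ 0) (γ 0) (tmap ℝ 𝔤 γ 0 1)
    + tmap 𝔤 𝔤 (fun z : G => γ 0 * z) (δ 0) (tmap ℝ 𝔤 δ 0 1) = _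
  rw [e3, e4]
  rfl

theorem tmap_curve_comp_mul {γ : ℝ → G} (hγ : DiffAt ℝ 𝔤 γ 0) (c : ℝ) :
    DiffAt ℝ 𝔤 (fun t => γ (c * t)) 0 ∧
      tmap ℝ 𝔤 (fun t => γ (c * t)) 0 1 = c • tmap ℝ 𝔤 γ 0 1 := by
  have h0 : HasFDerivAt (fun t : ℝ => c * t) (c • ContinuousLinearMap.id ℝ ℝ) 0 :=
    (hasFDerivAt_id (0 : ℝ)).const_mul c
  have h1 : DiffAt ℝ ℝ (fun t : ℝ => c * t) 0 := h0.hasMFDerivAt.mdifferentiableAt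
  have h2 : tmap ℝ ℝ (fun t : ℝ => c * t) 0 = c • ContinuousLinearMap.id ℝ ℝ :=
    h0.hasMFDerivAt.mfderiv
  refine ⟨DiffAt.comp (mul_zero c) hγ h1, ?_⟩
  have h3 := tmap_comp_apply (mul_zero c) hγ h1 1
  rw [h3, h2, ← map_smul]
  simp

/-- The Lie algebra of a closed subgroup `H` of `G`, that is, its tangent space at `1`: the
velocities at `0` of the curves in `H` that pass through `1` at time `0`. -/
def lieOfSubgroup (H : Subgroup G) : Submodule ℝ 𝔤 where
  carrier := {ξ | ∃ γ : ℝ → G, IsVelocity H γ ξ}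
  zero_mem' := by
    refine ⟨fun _ => 1, rfl, fun _ => H.one_mem, mdifferentiableAt_const, ?_⟩
    rw [tmap_const]
    rfl
  add_mem' := by
    rintro ξ η ⟨γ, h1, h2, h3, h4⟩ ⟨δ, k1, k2, k3, k4⟩
    obtain ⟨a, b⟩ := tmap_mul_curve h1 k1 h3 k3
    exact ⟨fun t => γ t * δ t, by simp [h1, k1], fun t => H.mul_mem (h2 t) (k2 t), a,
      by rw [b, h4, k4]⟩
  smul_mem' := by
    rintro c ξ ⟨γ, h1, h2, h3, h4⟩
    obtain ⟨a, b⟩ := tmap_curve_comp_mul h3 c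
    exact ⟨fun t => γ (c * t), by simp [h1], fun t => h2 _, a, by rw [b, h4]⟩

theorem IsVelocity.conj {H : Subgroup G} {γ : ℝ → G} {ξ : 𝔤} (h : IsVelocity H γ ξ) {g : G}
    (hg : g ∈ H) : IsVelocity H (fun t => g * γ t * g⁻¹) (Ad 𝔤 g ξ) := by
  obtain ⟨h1, h2, h3, h4⟩ := h
  refine ⟨by simp [h1], fun t => H.mul_mem (H.mul_mem hg (h2 t)) (H.inv_mem hg),
    DiffAt.comp h1 (diffAt_conj g 1) h3, ?_⟩
  have := tmap_comp h1 (diffAt_conj (𝔤 := 𝔤) g 1) h3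
  rw [← h4]
  exact congrArg (fun f : ℝ →L[ℝ] 𝔤 => f 1) this

theorem Ad_mem_lieOfSubgroup {H : Subgroup G} {g : G} (hg : g ∈ H) {ξ : 𝔤}
    (hξ : ξ ∈ lieOfSubgroup H) : Ad 𝔤 g ξ ∈ lieOfSubgroup (𝔤 := 𝔤) H := by
  obtain ⟨γ, h⟩ := hξ
  exact ⟨_, h.conj hg⟩

theorem lieOfSubgroup_mono {H K : Subgroup G} (h : H ≤ K) :
    lieOfSubgroup (𝔤 := 𝔤) H ≤ lieOfSubgroup K := by
  rintro ξ ⟨γ, h1, h2, h3⟩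
  exact ⟨γ, h1, fun t => h (h2 t), h3⟩

end
end Group

/-! ### Symplectic forms -/

section Symplectic

variable (E : Type*) [NormedAddCommGroup E] [NormedSpace ℝ E]
  (M : Type*) [TopologicalSpace M] [ChartedSpace E M]

/-- The local expression of a 2-form on `M` in the chart at `x₀`, i.e. its pullback by the inverse
of that chart. -/
noncomputable def chartForm {E : Type*} [NormedAddCommGroup E] [NormedSpace ℝ E]
    {M : Type*} [TopologicalSpace M] [ChartedSpace E M]
    (σ : M → E [⋀^Fin 2]→L[ℝ] ℝ) (x₀ : M) (u : E) : E [⋀^Fin 2]→L[ℝ] ℝ :=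
  (σ ((extChartAt 𝓘(ℝ, E) x₀).symm u)).compContinuousLinearMap
    (tmap E E (extChartAt 𝓘(ℝ, E) x₀).symm u)

/-- A symplectic form on `M`: a smooth, closed, nondegenerate 2-form. The alternating form `form m`
lives on `T_m M`; smoothness and closedness are expressed in the charts of `M`. -/
structure SymplecticForm where
  form : M → E [⋀^Fin 2]→L[ℝ] ℝ
  smooth : ∀ x₀ : M, ContDiffOn ℝ ∞ (chartForm form x₀) (extChartAt 𝓘(ℝ, E) x₀).target
  closed : ∀ x₀ : M, ∀ u ∈ (extChartAt 𝓘(ℝ, E) x₀).target, extDeriv (chartForm form x₀) u = 0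
  nondegenerate : ∀ (m : M) (v : E), (∀ w : E, form m ![v, w] = 0) → v = 0

end Symplectic

/-! ### Hamiltonian actions -/

section Hamiltonian

variable {𝔤 : Type*} [NormedAddCommGroup 𝔤] [NormedSpace ℝ 𝔤]
  {G : Type*} [TopologicalSpace G] [ChartedSpace 𝔤 G] [Group G]
  {E : Type*} [NormedAddCommGroup E] [NormedSpace ℝ E]
  {M : Type*} [TopologicalSpace M] [ChartedSpace E M] [MulAction G M]

variable (𝔤 G E) in
/-- `ξ ↦ ξ_M(m)`, where `ξ_M` is the vector field on `M` induced by `ξ`: the derivative at `1` of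
`g ↦ g • m`. -/
noncomputable def inducedField (m : M) : 𝔤 →L[ℝ] E := tmap 𝔤 E (fun g : G => g • m) 1

variable (𝔤 G E M) in
/-- A Hamiltonian action of `G` on a symplectic manifold `M` together with an equivariant momentum
map `F : M → 𝔤*`: the action preserves the symplectic form, `d⟨F, ξ⟩ = ω(ξ_M, ·)`, and
`F (g • m) = g · F m`. -/
structure HamiltonianAction extends SymplecticForm E M where
  invariant : ∀ (g : G) (m : M) (v w : E),
    form (g • m) ![tmap E E (fun p : M => g • p) m v, tmap E E (fun p : M => g • p) m w] = form m ![v, w]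
  momentum : M → StrongDual ℝ 𝔤
  momentum_smooth : ContMDiff 𝓘(ℝ, E) 𝓘(ℝ, StrongDual ℝ 𝔤) ∞ momentum
  momentum_eq : ∀ (m : M) (ξ : 𝔤) (w : E),
    tmap E (StrongDual ℝ 𝔤) momentum m w ξ = form m ![inducedField 𝔤 G E m ξ, w]
  equivariant : ∀ (g : G) (m : M), momentum (g • m) = coAd g (momentum m)

/-- The linear action of the isotropy group `G_x` on `T_x M` (the isotropy representation). -/
noncomputable def isotropyRep (x : M) (h : MulAction.stabilizer G x) : E →L[ℝ] E :=
  tmap E E (fun m : M => h.1 • m) x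

variable (𝔤 G E) in
/-- The infinitesimal isotropy representation `ξ ↦ ξ · v`, for `v ∈ T_x M`: the derivative at
`1` of `g ↦ T_x(g •) v`, with the vectors `T_x(g •) v ∈ T_{g • x} M` read in the chart at `x`.
It is used only for `ξ` in the Lie algebra of `G_x`, where it is the derivative of the isotropy
representation and does not depend on the chart, see `hasDerivAt_isotropyRep`. -/
noncomputable def isotropyInf (x : M) (v : E) : 𝔤 →L[ℝ] E :=
  tmap 𝔤 E (fun g : G => tmap E E (fun m : M => extChartAt 𝓘(ℝ, E) x (g • m)) x v) 1

section
variable [LieGroup 𝓘(ℝ, 𝔤) ∞ G] [IsManifold 𝓘(ℝ, E) ∞ M] [ContMDiffSMul 𝓘(ℝ, 𝔤) 𝓘(ℝ, E) ∞ G M]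

theorem diffAt_smul (hs : ContMDiffSMul 𝓘(ℝ, 𝔤) 𝓘(ℝ, E) ∞ G M) (g : G) (m : M) : DiffAt E E (fun p : M => g • p) m := by
  have h : ContMDiff 𝓘(ℝ, E) 𝓘(ℝ, E) ∞ (fun p : M => g • p) :=
    (contMDiff_smul (I := 𝓘(ℝ, 𝔤)) (I' := 𝓘(ℝ, E)) (n := ∞) (G := G) (M := M)).comp
      (contMDiff_const.prodMk contMDiff_id)
  exact h.contMDiffAt.mdifferentiableAt (by simp)

theorem diffAt_isotropyInf (x : M) (v : E) :
    DiffAt 𝔤 E (fun g : G => tmap E E (fun m : M => extChartAt 𝓘(ℝ, E) x (g • m)) x v) 1 := by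
  have h1 : ContMDiffAt (𝓘(ℝ, 𝔤).prod 𝓘(ℝ, E)) 𝓘(ℝ, E) ∞
      (Function.uncurry fun (g : G) (m : M) => extChartAt 𝓘(ℝ, E) x (g • m)) (1, x) := by
    have h2 := (contMDiff_smul (I := 𝓘(ℝ, 𝔤)) (I' := 𝓘(ℝ, E)) (n := ∞) (G := G)
      (M := M)).contMDiffAt (x := ((1 : G), x))
    exact ContMDiffAt.comp_of_eq (contMDiffAt_extChartAt (I := 𝓘(ℝ, E)) (n := ∞) (x := x)) h2
      (one_smul G x)
  have h3 := ContMDiffAt.mfderiv_apply (m := 1) (x₀ := (1 : G))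
    (fun (g : G) (m : M) => extChartAt 𝓘(ℝ, E) x (g • m)) (fun _ => x) id (fun _ => v) h1
    contMDiffAt_const contMDiffAt_id contMDiffAt_const (by decide)
  have h4 := h3.mdifferentiableAt (by simp)
  have h5 : (fun g : G => tmap E E (fun m : M => extChartAt 𝓘(ℝ, E) x (g • m)) x v)
      = fun g : G => inTangentCoordinates 𝓘(ℝ, E) 𝓘(ℝ, E) (fun _ : G => x)
        (fun g : G => extChartAt 𝓘(ℝ, E) x (g • x))
        (fun g : G => tmap E E (fun m : M => extChartAt 𝓘(ℝ, E) x (g • m)) x) 1 g v := by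
    funext g
    rw [inTangentCoordinates_eq _ _ _ (mem_chart_source E x)
      (by rw [chartAt_self_eq]; trivial)]
    have h6 : (tangentBundleCore 𝓘(ℝ, E) M).coordChange (achart E x) (achart E x) x v = v :=
      tangentCoordChange_self (I := 𝓘(ℝ, E)) (x := x) (z := x) (v := v) (mem_extChartAt_source x)
    simp only [ContinuousLinearMap.comp_apply]
    rw [h6]
    simp only [tangentBundleCore_coordChange_model_space, ContinuousLinearMap.id_apply]
  rw [h5]
  exact h4

theorem tmap_extChartAt_smul (x : M) (h : MulAction.stabilizer G x)
    (hs : ContMDiffSMul 𝓘(ℝ, 𝔤) 𝓘(ℝ, E) ∞ G M) (v : E) :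
    tmap E E (fun m : M => extChartAt 𝓘(ℝ, E) x (h.1 • m)) x v = isotropyRep x h v := by
  rw [tmap_comp_apply (g := extChartAt 𝓘(ℝ, E) x) (f := fun m : M => h.1 • m)
    (MulAction.mem_stabilizer_iff.1 h.2) (mdifferentiableAt_extChartAt (mem_chart_source E x))
    (diffAt_smul hs h.1 x), tmap_extChartAt_self]
  rfl

/-- For a curve `γ` in `G_x` with `γ 0 = 1` and velocity `ξ`, the derivative at `0` of
`γ t · v` is `ξ · v`. -/
theorem hasDerivAt_isotropyRep (x : M) (v : E) {γ : ℝ → G} {ξ : 𝔤}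
    (h : IsVelocity (MulAction.stabilizer G x) γ ξ) :
    HasDerivAt (fun t => isotropyRep x ⟨γ t, h.2.1 t⟩ v) (isotropyInf 𝔤 G E x v ξ) 0 := by
  obtain ⟨h1, h2, h3, h4⟩ := h
  have k1 := DiffAt.comp h1 (diffAt_isotropyInf (𝔤 := 𝔤) (G := G) x v) h3
  have k2 := tmap_comp_apply h1 (diffAt_isotropyInf (𝔤 := 𝔤) (G := G) x v) h3 1
  have k3 : (fun t => tmap E E (fun m : M => extChartAt 𝓘(ℝ, E) x (γ t • m)) x v)
      = fun t => isotropyRep x ⟨γ t, h2 t⟩ v :=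
    funext fun t => tmap_extChartAt_smul (𝔤 := 𝔤) x ⟨γ t, h2 t⟩ inferInstance v
  rw [k3, h4] at k2
  rw [k3] at k1
  have k4 : DifferentiableAt ℝ (fun t => isotropyRep x ⟨γ t, h2 t⟩ v) 0 :=
    mdifferentiableAt_iff_differentiableAt.1 k1
  have k5 : tmap ℝ E (fun t => isotropyRep x ⟨γ t, h2 t⟩ v) 0
      = fderiv ℝ (fun t => isotropyRep x ⟨γ t, h2 t⟩ v) 0 := mfderiv_eq_fderiv
  rw [k5] at k2
  have k6 := k4.hasDerivAt
  rw [← fderiv_apply_one_eq_deriv, k2] at k6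
  exact k6

theorem isotropyRep_one (x : M) :
    isotropyRep (E := E) x (1 : MulAction.stabilizer G x) = ContinuousLinearMap.id ℝ E := by
  have : (fun m : M => (1 : MulAction.stabilizer G x).1 • m) = id := by ext; simp
  rw [isotropyRep, this, tmap_id]

theorem isotropyRep_mul (hs : ContMDiffSMul 𝓘(ℝ, 𝔤) 𝓘(ℝ, E) ∞ G M) (x : M)
    (h k : MulAction.stabilizer G x) (v : E) :
    isotropyRep x (h * k) v = isotropyRep x h (isotropyRep x k v) := by
  have : (fun m : M => (h * k).1 • m) = fun m : M => h.1 • k.1 • m := by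
    ext; simp [mul_smul]
  rw [isotropyRep, this, tmap_comp_apply (g := fun m : M => h.1 • m) (f := fun m : M => k.1 • m)
    (MulAction.mem_stabilizer_iff.1 k.2) (diffAt_smul hs _ _) (diffAt_smul hs _ _)]
  rfl

/-- The infinitesimal isotropy representation is equivariant: `Ad(h) ξ · (h v) = h (ξ · v)` for
`h ∈ G_x` and `ξ` in the Lie algebra of `G_x`. -/
theorem isotropyInf_equivariant (x : M) (h : MulAction.stabilizer G x) (v : E) {ξ : 𝔤}
    (hξ : ξ ∈ lieOfSubgroup (𝔤 := 𝔤) (MulAction.stabilizer G x)) :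
    isotropyInf 𝔤 G E x (isotropyRep x h v) (Ad 𝔤 h.1 ξ)
      = isotropyRep x h (isotropyInf 𝔤 G E x v ξ) := by
  have hs : ContMDiffSMul 𝓘(ℝ, 𝔤) 𝓘(ℝ, E) ∞ G M := inferInstance
  obtain ⟨γ, hγ⟩ := hξ
  have h1 := hasDerivAt_isotropyRep x (isotropyRep x h v) (hγ.conj h.2)
  have h2 := (isotropyRep (E := E) x h).hasFDerivAt.comp_hasDerivAt (0 : ℝ)
    (hasDerivAt_isotropyRep x v hγ)
  refine h1.unique (h2.congr_of_eventuallyEq (Filter.Eventually.of_forall fun t => ?_))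
  have e : (⟨h.1 * γ t * h.1⁻¹, (hγ.conj h.2).2.1 t⟩ : MulAction.stabilizer G x) * h
      = h * ⟨γ t, hγ.2.1 t⟩ := by
    ext; simp
  change isotropyRep x _ (isotropyRep x h v) = isotropyRep x h (isotropyRep x _ v)
  rw [← isotropyRep_mul hs, e, isotropyRep_mul hs]

end
end Hamiltonian

/-! ### The model space and its momentum map -/

section Model

theorem projectionOnto_comm {W : Type*} [AddCommGroup W] [Module ℝ W] {p q : Submodule ℝ W}
    (hpq : IsCompl p q) (L : W →ₗ[ℝ] W) (hp : ∀ w ∈ p, L w ∈ p) (hq : ∀ w ∈ q, L w ∈ q) (w : W) :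
    (p.projectionOnto q hpq (L w)).1 = L (p.projectionOnto q hpq w).1 := by
  obtain ⟨a, ha, b, hb, rfl⟩ : ∃ a ∈ p, ∃ b ∈ q, a + b = w :=
    Submodule.mem_sup.1 (hpq.sup_eq_top ▸ Submodule.mem_top)
  rw [map_add, map_add, map_add, Submodule.projectionOnto_apply_of_mem_left hpq ha,
    Submodule.projectionOnto_apply_of_mem_right hpq hb,
    Submodule.projectionOnto_apply_of_mem_left hpq (hp a ha),
    Submodule.projectionOnto_apply_of_mem_right hpq (hq b hb)]
  simp

variable {𝔤 : Type*} [NormedAddCommGroup 𝔤] [NormedSpace ℝ 𝔤]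
  {G : Type*} [TopologicalSpace G] [ChartedSpace 𝔤 G] [Group G] [LieGroup 𝓘(ℝ, 𝔤) ∞ G]
  {E : Type*} [NormedAddCommGroup E] [NormedSpace ℝ E]
  {M : Type*} [TopologicalSpace M] [ChartedSpace E M] [MulAction G M]

/-- The linear form `v ↦ ω_m(v, w)` on `T_m M`. -/
def SymplecticForm.pairing (σ : SymplecticForm E M) (m : M) (w : E) : E →ₗ[ℝ] ℝ where
  toFun v := σ.form m ![v, w]
  map_add' v v' := (σ.form m).toAlternatingMap.map_vecCons_add ![w] v v'
  map_smul' c v := (σ.form m).toAlternatingMap.map_vecCons_smul ![w] c v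

/-- The symplectic perpendicular `W^ω = {v : ω_m(v, w) = 0 for all w ∈ W}` of `W ⊆ T_m M`. -/
def SymplecticForm.perp (σ : SymplecticForm E M) (m : M) (W : Submodule ℝ E) : Submodule ℝ E :=
  ⨅ w ∈ W, LinearMap.ker (σ.pairing m w)

variable (𝔤 G) in
/-- The Lie algebra `𝔤_x` of the isotropy group `G_x`. -/
def isotropyAlgebra (x : M) : Submodule ℝ 𝔤 := lieOfSubgroup (MulAction.stabilizer G x)

namespace HamiltonianAction

variable (A : HamiltonianAction 𝔤 G E M) (x : M)

/-- The Lie algebra `𝔤_α` of the coadjoint isotropy group `G_α`, where `α = F x`. -/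
def momentumIsotropyAlgebra : Submodule ℝ 𝔤 :=
  lieOfSubgroup (coadjointStabilizer G (A.momentum x))

/-- The tangent space `T_x(G · x) = {ξ_M(x) : ξ ∈ 𝔤}` of the orbit. -/
noncomputable def orbitTangent (_A : HamiltonianAction 𝔤 G E M) (x : M) : Submodule ℝ E :=
  LinearMap.range (inducedField 𝔤 G E x).toLinearMap

/-- The subspace `(𝔤_α)_M(x) = {ξ_M(x) : ξ ∈ 𝔤_α}` of `T_x M`. -/
noncomputable def nullTangent : Submodule ℝ E :=
  (A.momentumIsotropyAlgebra x).map (inducedField 𝔤 G E x).toLinearMap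

/-- The choices that enter the model of a neighbourhood of the orbit `G · x`: `G_x`-invariant
splittings `𝔤 = 𝔤_α ⊕ 𝔰`, `𝔤_α = 𝔤_x ⊕ 𝔪` and `T_x(G · x)^ω = (𝔤_α)_M(x) ⊕ V`. -/
structure Splitting where
  m : Submodule ℝ 𝔤
  s : Submodule ℝ 𝔤
  V : Submodule ℝ E
  isCompl_s : IsCompl (A.momentumIsotropyAlgebra x) s
  disjoint_m : Disjoint (isotropyAlgebra 𝔤 G x) m
  sup_m : isotropyAlgebra 𝔤 G x ⊔ m = A.momentumIsotropyAlgebra x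
  disjoint_V : Disjoint (A.nullTangent x) V
  sup_V : A.nullTangent x ⊔ V = A.perp x (A.orbitTangent x)
  invariant_m : ∀ h ∈ MulAction.stabilizer G x, ∀ ξ ∈ m, Ad 𝔤 h ξ ∈ m
  invariant_s : ∀ h ∈ MulAction.stabilizer G x, ∀ ξ ∈ s, Ad 𝔤 h ξ ∈ s
  invariant_V : ∀ (h : MulAction.stabilizer G x), ∀ v ∈ V, isotropyRep x h v ∈ V

theorem stabilizer_le :
    MulAction.stabilizer G x ≤ coadjointStabilizer G (A.momentum x) := by
  intro g hg
  change coAd g (A.momentum x) = A.momentum x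
  rw [← A.equivariant, MulAction.mem_stabilizer_iff.1 hg]

theorem Ad_mem_isotropyAlgebra {x : M} (h : MulAction.stabilizer G x) {ξ : 𝔤}
    (hξ : ξ ∈ isotropyAlgebra 𝔤 G x) : Ad 𝔤 h.1 ξ ∈ isotropyAlgebra 𝔤 G x :=
  Ad_mem_lieOfSubgroup h.2 hξ

theorem Ad_mem_momentumIsotropyAlgebra {x : M} (h : MulAction.stabilizer G x) {ξ : 𝔤}
    (hξ : ξ ∈ A.momentumIsotropyAlgebra x) : Ad 𝔤 h.1 ξ ∈ A.momentumIsotropyAlgebra x :=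
  Ad_mem_lieOfSubgroup (A.stabilizer_le x h.2) hξ

/-- The quotient `𝔤_α / 𝔤_x`. -/
abbrev IsotropyQuotient : Type _ :=
  A.momentumIsotropyAlgebra x ⧸
    (isotropyAlgebra 𝔤 G x).submoduleOf (A.momentumIsotropyAlgebra x)

/-- The adjoint action of `h ∈ G_x` on `𝔤_α`. -/
noncomputable def AdSub (h : MulAction.stabilizer G x) :
    A.momentumIsotropyAlgebra x →L[ℝ] A.momentumIsotropyAlgebra x :=
  ((Ad 𝔤 h.1).comp (A.momentumIsotropyAlgebra x).subtypeL).codRestrict _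
    fun ξ => A.Ad_mem_momentumIsotropyAlgebra h ξ.2

/-- The action of `h ∈ G_x` on `𝔤_α / 𝔤_x` induced by the adjoint action. -/
noncomputable def AdQuot (h : MulAction.stabilizer G x) :
    A.IsotropyQuotient x →L[ℝ] A.IsotropyQuotient x :=
  Submodule.liftQL _ ((Submodule.mkQL _).comp (A.AdSub x h)) (by
    intro ξ hξ
    have h1 : Ad 𝔤 h.1 ξ.1 ∈ isotropyAlgebra 𝔤 G x := Ad_mem_isotropyAlgebra h hξ
    exact (Submodule.Quotient.mk_eq_zero _).2 h1)

/-- The contragredient action of `h ∈ G_x` on `(𝔤_α / 𝔤_x)*`. -/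
noncomputable def dualAct (h : MulAction.stabilizer G x)
    (l : StrongDual ℝ (A.IsotropyQuotient x)) : StrongDual ℝ (A.IsotropyQuotient x) :=
  l.comp (A.AdQuot x h⁻¹)

theorem AdQuot_one : A.AdQuot x 1 = ContinuousLinearMap.id ℝ _ := by
  ext q
  obtain ⟨ξ, rfl⟩ := Submodule.Quotient.mk_surjective _ q
  change Submodule.Quotient.mk (A.AdSub x 1 ξ) = Submodule.Quotient.mk ξ
  congr 1
  ext
  exact congrArg (fun f : 𝔤 →L[ℝ] 𝔤 => f ξ.1) Ad_one

theorem AdQuot_mul (h k : MulAction.stabilizer G x) :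
    A.AdQuot x (h * k) = (A.AdQuot x h).comp (A.AdQuot x k) := by
  ext q
  obtain ⟨ξ, rfl⟩ := Submodule.Quotient.mk_surjective _ q
  change Submodule.Quotient.mk (A.AdSub x (h * k) ξ)
    = Submodule.Quotient.mk (A.AdSub x h (A.AdSub x k ξ))
  congr 1
  ext
  exact congrArg (fun f : 𝔤 →L[ℝ] 𝔤 => f ξ.1) (Ad_mul h.1 k.1)

theorem dualAct_one (l : StrongDual ℝ (A.IsotropyQuotient x)) : A.dualAct x 1 l = l := by
  rw [dualAct, inv_one, AdQuot_one, ContinuousLinearMap.comp_id]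

theorem dualAct_mul (h k : MulAction.stabilizer G x) (l : StrongDual ℝ (A.IsotropyQuotient x)) :
    A.dualAct x (h * k) l = A.dualAct x h (A.dualAct x k l) := by
  simp only [dualAct, mul_inv_rev, AdQuot_mul, ContinuousLinearMap.comp_assoc]

namespace Splitting

variable {A x} (S : A.Splitting x)

theorem isCompl_sup : IsCompl (isotropyAlgebra 𝔤 G x) (S.m ⊔ S.s) := by
  constructor
  · have h := S.isCompl_s.disjoint
    rw [← S.sup_m] at h
    exact S.disjoint_m.disjoint_sup_right_of_disjoint_sup_left h
  · rw [codisjoint_iff, ← sup_assoc, S.sup_m]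
    exact S.isCompl_s.sup_eq_top

section Maps
variable [FiniteDimensional ℝ 𝔤]

/-- The projection `𝔤 → 𝔤_α` along `𝔰`. -/
noncomputable def projAlpha : 𝔤 →L[ℝ] A.momentumIsotropyAlgebra x :=
  ((A.momentumIsotropyAlgebra x).projectionOnto S.s S.isCompl_s).toContinuousLinearMap

/-- The projection `𝔤 → 𝔤_x` along `𝔪 ⊕ 𝔰`. -/
noncomputable def projIso : 𝔤 →L[ℝ] isotropyAlgebra 𝔤 G x :=
  ((isotropyAlgebra 𝔤 G x).projectionOnto (S.m ⊔ S.s) S.isCompl_sup).toContinuousLinearMap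

/-- The embedding `j : (𝔤_α / 𝔤_x)* → 𝔤*`. -/
noncomputable def j (l : StrongDual ℝ (A.IsotropyQuotient x)) : StrongDual ℝ 𝔤 :=
  l.comp ((Submodule.mkQL _).comp S.projAlpha)

/-- The embedding `i : 𝔤_x* → 𝔤*`. -/
noncomputable def i (ν : StrongDual ℝ (isotropyAlgebra 𝔤 G x)) : StrongDual ℝ 𝔤 :=
  ν.comp S.projIso

/-- The momentum map `F_V : V → 𝔤_x*` of the linear symplectic action of `G_x` on `V`:
`⟨F_V v, ξ⟩ = ½ ω_x(ξ · v, v)`. -/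
noncomputable def FV (v : S.V) : StrongDual ℝ (isotropyAlgebra 𝔤 G x) :=
  LinearMap.toContinuousLinearMap
    ((1 / 2 : ℝ) • (A.pairing x v.1 ∘ₗ (isotropyInf 𝔤 G E x v.1).toLinearMap ∘ₗ
      (isotropyAlgebra 𝔤 G x).subtype))

theorem FV_apply (v : S.V) (ξ : isotropyAlgebra 𝔤 G x) :
    S.FV v ξ = 1 / 2 * A.form x ![isotropyInf 𝔤 G E x v.1 ξ.1, v.1] := rfl

end Maps

/-- The action of `h ∈ G_x` on `V`. -/
noncomputable def VAct (h : MulAction.stabilizer G x) (v : S.V) : S.V :=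
  ⟨isotropyRep x h v.1, S.invariant_V h v.1 v.2⟩

section Space
variable [IsManifold 𝓘(ℝ, E) ∞ M] [ContMDiffSMul 𝓘(ℝ, 𝔤) 𝓘(ℝ, E) ∞ G M]

theorem VAct_one (v : S.V) : S.VAct 1 v = v := by
  ext
  exact congrArg (fun f : E →L[ℝ] E => f v.1) (isotropyRep_one (G := G) x)

theorem VAct_mul (h k : MulAction.stabilizer G x) (v : S.V) :
    S.VAct (h * k) v = S.VAct h (S.VAct k v) := by
  ext
  exact isotropyRep_mul (𝔤 := 𝔤) inferInstance x h k v.1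

/-- The equivalence relation on `G × ((𝔤_α / 𝔤_x)* × V)` whose classes are the orbits of `G_x`
acting by `h · (g, λ, v) = (g h⁻¹, h · λ, h · v)`. -/
def modelSetoid : Setoid (G × StrongDual ℝ (A.IsotropyQuotient x) × S.V) where
  r p q := ∃ h : MulAction.stabilizer G x,
    q = (p.1 * h.1⁻¹, A.dualAct x h p.2.1, S.VAct h p.2.2)
  iseqv := by
    refine ⟨fun p => ⟨1, ?_⟩, ?_, ?_⟩
    · rw [A.dualAct_one, S.VAct_one]
      simp
    · rintro p q ⟨h, rfl⟩
      refine ⟨h⁻¹, ?_⟩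
      rw [← A.dualAct_mul, ← S.VAct_mul, inv_mul_cancel, A.dualAct_one, S.VAct_one]
      simp
    · rintro p q r ⟨h, rfl⟩ ⟨k, rfl⟩
      refine ⟨k * h, ?_⟩
      rw [A.dualAct_mul, S.VAct_mul]
      simp [mul_assoc]

/-- The model space `Y = G ×_{G_x} ((𝔤_α / 𝔤_x)* × V)`, with the quotient topology. -/
def Model : Type _ := Quotient S.modelSetoid

instance : TopologicalSpace S.Model := inferInstanceAs (TopologicalSpace (Quotient S.modelSetoid))

/-- The class `[g, λ, v]`. -/
def cls (g : G) (l : StrongDual ℝ (A.IsotropyQuotient x)) (v : S.V) : S.Model :=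
  Quotient.mk S.modelSetoid (g, l, v)

/-- The zero section of `Y`, which is the copy of the orbit `G · x` in `Y`. -/
def zeroSection : Set S.Model := Set.range fun g : G => S.cls g 0 0

variable [FiniteDimensional ℝ 𝔤]

theorem projAlpha_Ad (h : MulAction.stabilizer G x) (ξ : 𝔤) :
    S.projAlpha (Ad 𝔤 h.1 ξ) = A.AdSub x h (S.projAlpha ξ) := by
  ext
  exact projectionOnto_comm S.isCompl_s (Ad 𝔤 h.1).toLinearMap
    (fun ξ hξ => A.Ad_mem_momentumIsotropyAlgebra h hξ) (S.invariant_s h.1 h.2) ξ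

theorem projIso_Ad (h : MulAction.stabilizer G x) (ξ : 𝔤) :
    (S.projIso (Ad 𝔤 h.1 ξ)).1 = Ad 𝔤 h.1 (S.projIso ξ).1 := by
  refine projectionOnto_comm S.isCompl_sup (Ad 𝔤 h.1).toLinearMap
    (fun ξ hξ => Ad_mem_isotropyAlgebra h hξ) ?_ ξ
  intro η hη
  obtain ⟨a, ha, b, hb, rfl⟩ := Submodule.mem_sup.1 hη
  rw [map_add]
  exact Submodule.add_mem_sup (S.invariant_m h.1 h.2 a ha) (S.invariant_s h.1 h.2 b hb)

theorem j_dualAct (h : MulAction.stabilizer G x) (l : StrongDual ℝ (A.IsotropyQuotient x)) :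
    S.j (A.dualAct x h l) = coAd h.1 (S.j l) := by
  ext ξ
  change l (Submodule.Quotient.mk (A.AdSub x h⁻¹ (S.projAlpha ξ)))
    = l (Submodule.Quotient.mk (S.projAlpha (Ad 𝔤 h⁻¹.1 ξ)))
  rw [S.projAlpha_Ad]

theorem i_FV_VAct (h : MulAction.stabilizer G x) (v : S.V) :
    S.i (S.FV (S.VAct h v)) = coAd h.1 (S.i (S.FV v)) := by
  ext ξ
  change S.FV (S.VAct h v) (S.projIso ξ) = S.FV v (S.projIso (Ad 𝔤 h.1⁻¹ ξ))
  rw [FV_apply, FV_apply]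
  have h1 : (S.projIso (Ad 𝔤 h.1⁻¹ ξ)).1 = Ad 𝔤 h.1⁻¹ (S.projIso ξ).1 := S.projIso_Ad h⁻¹ ξ
  have h2 : Ad 𝔤 h.1⁻¹ (S.projIso ξ).1 ∈ isotropyAlgebra 𝔤 G x :=
    Ad_mem_isotropyAlgebra h⁻¹ (S.projIso ξ).2
  have h3 := isotropyInf_equivariant x h v.1 h2
  rw [Ad_apply_Ad_inv] at h3
  have h4 := A.invariant h.1 x (isotropyInf 𝔤 G E x v.1 (Ad 𝔤 h.1⁻¹ (S.projIso ξ).1)) v.1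
  rw [MulAction.mem_stabilizer_iff.1 h.2] at h4
  rw [h1, ← h4]
  change 1 / 2 * A.form x ![isotropyInf 𝔤 G E x (isotropyRep x h v.1) _, isotropyRep x h v.1] = _
  rw [h3]
  rfl

/-- The momentum map `F_Y : Y → 𝔤*`, `[g, λ, v] ↦ g · (α + j(λ) + i(F_V(v)))`. -/
noncomputable def FY : S.Model → StrongDual ℝ 𝔤 :=
  Quotient.lift (fun p => coAd p.1 (A.momentum x + S.j p.2.1 + S.i (S.FV p.2.2))) (by
    rintro p q ⟨h, rfl⟩
    have h1 : coAd h.1 (A.momentum x) = A.momentum x := A.stabilizer_le x h.2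
    have h2 : A.momentum x + S.j (A.dualAct x h p.2.1) + S.i (S.FV (S.VAct h p.2.2))
        = coAd h.1 (A.momentum x + S.j p.2.1 + S.i (S.FV p.2.2)) := by
      rw [S.j_dualAct, S.i_FV_VAct]
      conv_lhs => rw [← h1]
      rfl
    change _ = coAd (p.1 * h.1⁻¹) _
    rw [h2, ← coAd_mul, inv_mul_cancel_right])

theorem FY_cls (g : G) (l : StrongDual ℝ (A.IsotropyQuotient x)) (v : S.V) :
    S.FY (S.cls g l v) = coAd g (A.momentum x + S.j l + S.i (S.FV v)) := rfl

end Space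
end Splitting
end HamiltonianAction
end Model
end HamiltonianModel

/-! The coadjoint orbit is `G`-invariant, so `[g, λ, v]` is mapped into `G · α` exactly when `α +
j(λ) + i(F_V(v))` lies in `G · α`. Both `j` and `i` take values in the annihilator `𝔰°` of `𝔰`
(`slice`), and together they are injective there. It therefore suffices to find a neighbourhood `W`
of `α` in which `G · α` meets the affine space `α + 𝔰°` only at `α`; then `Y₀` consists of the
classes having a representative whose fibre momentum is in `W` (`tube`).

Infinitesimally this is transversality (`disjoint_range_slice`). The derivative at `1` of `g ↦ g ·
α` in the direction `ξ` is the form `η ↦ ω_x(η_M(x), ξ_M(x))`. By antisymmetry it vanishes on `𝔤_α`,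
so it is zero as soon as it also vanishes on the complement `𝔰`.

Two arguments turn this into a statement about points. The orbit map has constant rank by
homogeneity, so for group elements near `1` it meets `α + 𝔰°` only at `α`
(`eventually_eq_one_of_sub_mem`). Other group elements might still carry `α` back close to itself.
Local closedness excludes this: the orbit is then a Baire space, and the open mapping theorem for
transitive actions shows that each orbit point near `α` is `g · α` with `g` near `1`
(`exists_coAd_eq_of_isLocallyClosed`). The two combine in `exists_slice_nhd`. -/

namespace HamiltonianModel

open Filter Topology

/-! ### A constant rank argument in normed spaces -/

section Analysis

variable {X Z T : Type*} [NormedAddCommGroup X] [NormedSpace ℝ X]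
  [NormedAddCommGroup Z] [NormedSpace ℝ Z] [NormedAddCommGroup T] [NormedSpace ℝ T]

/-- Surjectivity onto a finite-dimensional space is an open condition. -/
theorem eventually_surjective [FiniteDimensional ℝ T] {L : X → X →L[ℝ] T} {u₀ : X}
    (hL : ContinuousAt L u₀) (hs : Function.Surjective (L u₀)) :
    ∀ᶠ u in 𝓝 u₀, Function.Surjective (L u) := by
  -- With a right inverse `R` of `L u₀`, it is enough that `L u ∘ R` be invertible; it is the
  -- identity at `u₀`, and the units of the Banach algebra `T →L[ℝ] T` form an open set.
  obtain ⟨R, hR⟩ := (L u₀).toLinearMap.exists_rightInverse_of_surjective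
    (LinearMap.range_eq_top.2 hs)
  have hR' : (L u₀).comp R.toContinuousLinearMap = 1 := by
    ext t
    exact congrArg (fun f : T →ₗ[ℝ] T => f t) hR
  have hc : ContinuousAt (fun u => (L u).comp R.toContinuousLinearMap) u₀ :=
    hL.clm_comp continuousAt_const
  have : CompleteSpace T := FiniteDimensional.complete ℝ T
  have h1 : ∀ᶠ u in 𝓝 u₀, IsUnit ((L u).comp R.toContinuousLinearMap) := by
    refine hc.eventually (Units.isOpen.mem_nhds ?_)
    change IsUnit ((L u₀).comp R.toContinuousLinearMap)
    rw [hR']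
    exact isUnit_one
  filter_upwards [h1] with u hu t
  obtain ⟨w, hw⟩ := hu.exists_right_inv
  exact ⟨R (w t), congrArg (fun f : T →L[ℝ] T => f t) hw⟩

/-- If `P ∘ L` is onto and the rank of `L` is at most the dimension of the target of `P`, then `P`
is injective on the range of `L`. -/
theorem eq_zero_of_surjective_comp [FiniteDimensional ℝ Z] [FiniteDimensional ℝ T]
    {L : X →L[ℝ] Z} {P : Z →L[ℝ] T} (hs : Function.Surjective (P.comp L))
    (hr : Module.finrank ℝ (LinearMap.range L.toLinearMap) ≤ Module.finrank ℝ T)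
    (v : X) (hv : P (L v) = 0) : L v = 0 := by
  -- The restriction of `P` to the range of `L` is still onto, so rank-nullity and the bound `hr`
  -- leave no room for a kernel.
  set Q : LinearMap.range L.toLinearMap →ₗ[ℝ] T := P.toLinearMap.domRestrict _ with hQ
  have hQs : Function.Surjective Q := fun t => by
    obtain ⟨w, hw⟩ := hs t
    exact ⟨⟨L w, w, rfl⟩, hw⟩
  have h1 : Module.finrank ℝ (LinearMap.range Q) = Module.finrank ℝ T := by
    rw [LinearMap.range_eq_top.2 hQs, finrank_top]
  have h2 := LinearMap.finrank_range_add_finrank_ker Q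
  have h3 : Module.finrank ℝ (LinearMap.ker Q) = 0 := by omega
  have h4 : LinearMap.ker Q = ⊥ := Submodule.finrank_eq_zero.1 h3
  have h5 : (⟨L v, v, rfl⟩ : LinearMap.range L.toLinearMap) ∈ LinearMap.ker Q := hv
  rw [h4, Submodule.mem_bot] at h5
  exact congrArg Subtype.val h5

/-- If `P ∘ f` is a submersion at `u₀` and `P` is injective on the range of the derivative of `f`
near `u₀`, then `f` is constant on the fibre of `P ∘ f` through `u₀`, near `u₀`. -/
theorem eventually_eq_of_comp_eq [FiniteDimensional ℝ X] [FiniteDimensional ℝ T]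
    {f : X → Z} {u₀ : X} (hf : ContDiffAt ℝ 1 f u₀) (P : Z →L[ℝ] T)
    (hs : Function.Surjective (P.comp (fderiv ℝ f u₀)))
    (hi : ∀ᶠ u in 𝓝 u₀, ∀ v, P (fderiv ℝ f u v) = 0 → fderiv ℝ f u v = 0) :
    ∀ᶠ u in 𝓝 u₀, P (f u) = P (f u₀) → f u = f u₀ := by
  have : CompleteSpace X := FiniteDimensional.complete ℝ X
  have : CompleteSpace T := FiniteDimensional.complete ℝ T
  set D : X →L[ℝ] T := P.comp (fderiv ℝ f u₀) with hD
  -- The projection `Q` onto the kernel of `D` supplies the coordinates that `P ∘ f` misses, so `(P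
  -- ∘ f, Q)` is a local diffeomorphism at `u₀` by the inverse function theorem.
  obtain ⟨q, hq⟩ := D.toLinearMap.ker.exists_isCompl
  set Q : X →L[ℝ] D.toLinearMap.ker :=
    (D.toLinearMap.ker.projectionOnto q hq).toContinuousLinearMap with hQ
  have hQr : Q.range = ⊤ := Submodule.range_projectionOnto hq
  have hQk : Q.ker = q := Submodule.ker_projectionOnto hq
  set φ' : X ≃L[ℝ] T × D.toLinearMap.ker :=
    ContinuousLinearMap.equivProdOfSurjectiveOfIsCompl D Q (LinearMap.range_eq_top.2 hs) hQr
      (hQk ▸ hq) with hφ'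
  set φ : X → T × D.toLinearMap.ker := fun u => (P (f u), Q u) with hφ
  have hφc : ContDiffAt ℝ 1 φ u₀ :=
    (P.contDiff.contDiffAt.comp u₀ hf).prodMk Q.contDiff.contDiffAt
  have hφd : HasFDerivAt φ (φ' : X →L[ℝ] T × D.toLinearMap.ker) u₀ := by
    have := (P.hasFDerivAt.comp u₀ (hf.differentiableAt one_ne_zero).hasFDerivAt).prodMk
      (Q.hasFDerivAt (x := u₀))
    exact this
  set e := hφc.toOpenPartialHomeomorph φ hφd one_ne_zero with he
  have hes : u₀ ∈ e.source := hφc.mem_toOpenPartialHomeomorph_source hφd one_ne_zero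
  have het : φ u₀ ∈ e.target := hφc.image_mem_toOpenPartialHomeomorph_target hφd one_ne_zero
  have hee : ∀ u, e u = φ u := fun u => rfl
  have hψc : ContDiffAt ℝ 1 e.symm (φ u₀) := hφc.to_localInverse hφd one_ne_zero
  have hψ0 : e.symm (φ u₀) = u₀ := e.left_inv hes
  have hψt : Tendsto e.symm (𝓝 (φ u₀)) (𝓝 u₀) := by
    have := hψc.continuousAt.tendsto
    rwa [hψ0] at this
  have hev : ∀ᶠ y in 𝓝 (φ u₀), y ∈ e.target ∧ DifferentiableAt ℝ e.symm y ∧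
      DifferentiableAt ℝ f (e.symm y) ∧
      ∀ v, P (fderiv ℝ f (e.symm y) v) = 0 → fderiv ℝ f (e.symm y) v = 0 := by
    refine Eventually.and (e.open_target.mem_nhds het) (((hψc.eventually (by simp)).mono
      fun y hy => hy.differentiableAt one_ne_zero).and (hψt.eventually
      (((hf.eventually (by simp)).mono fun y hy => hy.differentiableAt one_ne_zero).and hi)))
  obtain ⟨r, hr, hB⟩ := Metric.eventually_nhds_iff_ball.1 hev
  have hnear : ∀ᶠ u in 𝓝 u₀, u ∈ e.source ∧ φ u ∈ Metric.ball (φ u₀) r :=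
    Eventually.and (e.open_source.mem_nhds hes) (hφc.continuousAt.eventually (Metric.ball_mem_nhds _ hr))
  filter_upwards [hnear] with u hu hPu
  -- In these coordinates the fibre of `P ∘ f` through `u₀` is the slice on which the first
  -- coordinate equals `P (f u₀)`.
  set c : D.toLinearMap.ker → T × D.toLinearMap.ker := fun k => (P (f u₀), k) with hc
  have hcB : ∀ k ∈ Metric.ball (Q u₀) r, c k ∈ Metric.ball (φ u₀) r := by
    intro k hk
    rw [Metric.mem_ball, Prod.dist_eq]
    exact max_lt (by simpa [hc, hφ] using hr) hk
  have hder : ∀ k ∈ Metric.ball (Q u₀) r,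
      HasFDerivAt (fun k => f (e.symm (c k))) (0 : D.toLinearMap.ker →L[ℝ] Z) k := by
    intro k hk
    obtain ⟨b1, b2, b3, b4⟩ := hB _ (hcB k hk)
    have d1 : HasFDerivAt c (ContinuousLinearMap.inr ℝ T D.toLinearMap.ker) k :=
      hasFDerivAt_prodMk_right _ _
    have d2 := b3.hasFDerivAt.comp k (b2.hasFDerivAt.comp k d1)
    have d3 := P.hasFDerivAt.comp k d2
    have d4 : HasFDerivAt (fun _ : D.toLinearMap.ker => P (f u₀))
        (0 : D.toLinearMap.ker →L[ℝ] T) k := hasFDerivAt_const _ _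
    -- Along the slice `P ∘ f` is constant, hence `P` kills the derivative of `f` along it; by `hi`
    -- that derivative is itself zero.
    have d5 := d4.unique (d3.congr_of_eventuallyEq (by
      filter_upwards [Metric.isOpen_ball.mem_nhds hk] with k' hk'
      have := e.right_inv (hB _ (hcB k' hk')).1
      exact (congrArg Prod.fst this).symm))
    have d6 : (fderiv ℝ f (e.symm (c k))).comp ((fderiv ℝ e.symm (c k)).comp
        (ContinuousLinearMap.inr ℝ T D.toLinearMap.ker)) = 0 :=
      ContinuousLinearMap.ext fun v => b4 _
        (congrArg (fun f : D.toLinearMap.ker →L[ℝ] T => f v) d5).symm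
    rw [d6] at d2
    exact d2
  have hQu : Q u ∈ Metric.ball (Q u₀) r := by
    have := hu.2
    rw [Metric.mem_ball, Prod.dist_eq] at this
    exact (le_max_right _ _).trans_lt this
  have hconst := (convex_ball (Q u₀) r).is_const_of_fderivWithin_eq_zero (𝕜 := ℝ)
    (f := fun k => f (e.symm (c k)))
    (fun k hk => (hder k hk).differentiableAt.differentiableWithinAt)
    (fun k hk => by
      rw [fderivWithin_of_isOpen Metric.isOpen_ball hk]
      exact (hder k hk).fderiv) hQu (Metric.mem_ball_self hr)
  have e1 : c (Q u) = e u := by rw [hee, hc, hφ]; simp only [hPu]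
  have e2 : c (Q u₀) = e u₀ := rfl
  simp only [e1, e2, e.left_inv hu.1, e.left_inv hes] at hconst
  exact hconst

/-- If `f` has rank at most `dim T` near `u₀` and `P ∘ f` is a submersion at `u₀`, then `f` is
constant on the fibre of `P ∘ f` through `u₀`, near `u₀`. -/
theorem eventually_eq_of_comp_eq_of_finrank_le [FiniteDimensional ℝ X] [FiniteDimensional ℝ Z]
    [FiniteDimensional ℝ T] {f : X → Z} {u₀ : X} (hf : ContDiffAt ℝ 1 f u₀) (P : Z →L[ℝ] T)
    (hs : Function.Surjective (P.comp (fderiv ℝ f u₀)))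
    (hr : ∀ᶠ u in 𝓝 u₀,
      Module.finrank ℝ (LinearMap.range (fderiv ℝ f u).toLinearMap) ≤ Module.finrank ℝ T) :
    ∀ᶠ u in 𝓝 u₀, P (f u) = P (f u₀) → f u = f u₀ := by
  have hc : ContinuousAt (fun u => P.comp (fderiv ℝ f u)) u₀ :=
    continuousAt_const.clm_comp (hf.continuousAt_fderiv one_ne_zero)
  refine eventually_eq_of_comp_eq hf P hs ?_
  filter_upwards [eventually_surjective hc hs, hr] with u h1 h2 v hv
  exact eq_zero_of_surjective_comp h1 h2 v hv

end Analysis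

/-! ### Orbit maps of linear actions; locally closed coadjoint orbits -/

section Equivariant

variable {𝔤 : Type*} [NormedAddCommGroup 𝔤] [NormedSpace ℝ 𝔤] [FiniteDimensional ℝ 𝔤]
  {G : Type*} [TopologicalSpace G] [ChartedSpace 𝔤 G] [Group G] [LieGroup 𝓘(ℝ, 𝔤) ∞ G]
  {Z T : Type*} [NormedAddCommGroup Z] [NormedSpace ℝ Z] [FiniteDimensional ℝ Z]
  [NormedAddCommGroup T] [NormedSpace ℝ T] [FiniteDimensional ℝ T]

/-- A smooth orbit map `a : G → Z` of a linear action is determined near `1` by `P ∘ a`, on the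
fibre through `1`, if `P` restricts to an isomorphism on the range of the derivative of `a`. -/
theorem eventually_eq_one_of_comp_eq {a : G → Z} (ha : ContMDiff 𝓘(ℝ, 𝔤) 𝓘(ℝ, Z) ∞ a)
    (ρ : G → Z →L[ℝ] Z) (hρ : ∀ g k, a (g * k) = ρ g (a k)) (P : Z →L[ℝ] T)
    (hs : Function.Surjective (P.comp (tmap 𝔤 Z a 1)))
    (hr : Module.finrank ℝ (LinearMap.range (tmap 𝔤 Z a 1).toLinearMap) ≤ Module.finrank ℝ T) :
    ∀ᶠ g in 𝓝 (1 : G), P (a g) = P (a 1) → a g = a 1 := by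
  have : IsManifold 𝓘(ℝ, 𝔤) ∞ G := inferInstance
  set e := extChartAt 𝓘(ℝ, 𝔤) (1 : G) with he
  set u₀ := e 1 with hu₀
  set f : 𝔤 → Z := fun u => a (e.symm u) with hf
  have hsymm : ∀ u ∈ e.target, ContMDiffAt 𝓘(ℝ, 𝔤) 𝓘(ℝ, 𝔤) ∞ e.symm u := fun u hu =>
    (contMDiffOn_extChartAt_symm (1 : G)).contMDiffAt
      ((isOpen_extChartAt_target (I := 𝓘(ℝ, 𝔤)) (1 : G)).mem_nhds hu)
  have hu₀t : u₀ ∈ e.target := mem_extChartAt_target (1 : G)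
  have hfc : ContDiffAt ℝ 1 f u₀ := by
    have h1 : ContMDiffAt 𝓘(ℝ, 𝔤) 𝓘(ℝ, Z) ∞ f u₀ :=
      ContMDiffAt.comp u₀ ha.contMDiffAt (hsymm u₀ hu₀t)
    exact h1.contDiffAt.of_le (by simp)
  have hfd : DiffAt 𝔤 Z f u₀ :=
    (hfc.differentiableAt one_ne_zero).mdifferentiableAt
  have heq : ∀ᶠ g in 𝓝 (1 : G), e.symm (e g) = g :=
    eventually_of_mem (extChartAt_source_mem_nhds (I := 𝓘(ℝ, 𝔤)) (1 : G))
      fun g hg => e.left_inv hg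
  -- The derivative at `1` of the chart centred there is the identity, so passing to the chart does
  -- not change the derivative of `a` at `1`.
  have hder : tmap 𝔤 Z a 1 = fderiv ℝ f u₀ := by
    have h1 : a =ᶠ[𝓝 1] f ∘ e := heq.mono fun g hg => congrArg a hg.symm
    have h2 : tmap 𝔤 Z a 1 = tmap 𝔤 Z (f ∘ e) 1 := h1.mfderiv_eq
    have h3 : DiffAt 𝔤 𝔤 e 1 :=
      (contMDiffAt_extChartAt (I := 𝓘(ℝ, 𝔤)) (n := ∞)).mdifferentiableAt (by simp)
    have h4 : tmap 𝔤 𝔤 e 1 = ContinuousLinearMap.id ℝ 𝔤 := tmap_extChartAt_self 1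
    have h5 : tmap 𝔤 Z (f ∘ e) 1 = (tmap 𝔤 Z f u₀).comp (tmap 𝔤 𝔤 e 1) :=
      tmap_comp (f := e) (rfl : e 1 = u₀) hfd h3
    rw [h2, h5, h4, ContinuousLinearMap.comp_id]
    exact mfderiv_eq_fderiv
  have hrank : ∀ᶠ u in 𝓝 u₀,
      Module.finrank ℝ (LinearMap.range (fderiv ℝ f u).toLinearMap) ≤ Module.finrank ℝ T := by
    filter_upwards [(isOpen_extChartAt_target (I := 𝓘(ℝ, 𝔤)) (1 : G)).mem_nhds hu₀t] with u hu
    set g := e.symm u with hg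
    -- Homogeneity bounds the rank: with `g` the point at `u`, `f = ρ g ∘ a ∘ b` and `b u = 1`, so
    -- the derivative of `f` at `u` factors through that of `a` at `1`.
    set b : 𝔤 → G := fun w => g⁻¹ * e.symm w with hb
    have hbd : DiffAt 𝔤 𝔤 b u :=
      (ContMDiffAt.mul (I := 𝓘(ℝ, 𝔤)) contMDiffAt_const (hsymm u hu)).mdifferentiableAt (by simp)
    have hb1 : b u = 1 := inv_mul_cancel g
    have had : DiffAt 𝔤 Z a 1 := ha.contMDiffAt.mdifferentiableAt (by simp)
    have hab : DiffAt 𝔤 Z (a ∘ b) u := DiffAt.comp (g := a) (f := b) hb1 had hbd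
    have hab' : DifferentiableAt ℝ (a ∘ b) u := mdifferentiableAt_iff_differentiableAt.1 hab
    have h1 : f = fun w => ρ g ((a ∘ b) w) := by
      funext w
      simp only [hf, hb, Function.comp_apply, ← hρ, mul_inv_cancel_left]
    have h2 : fderiv ℝ f u = (ρ g).comp ((tmap 𝔤 Z a 1).comp (tmap 𝔤 𝔤 b u)) := by
      rw [h1, ← tmap_comp hb1 had hbd]
      have h3 := ((ρ g).hasFDerivAt.comp u hab'.hasFDerivAt).fderiv
      refine h3.trans ?_
      congr 1
      exact mfderiv_eq_fderiv.symm
    rw [h2]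
    refine le_trans ?_ hr
    calc Module.finrank ℝ (LinearMap.range
          ((ρ g).comp ((tmap 𝔤 Z a 1).comp (tmap 𝔤 𝔤 b u))).toLinearMap)
        ≤ Module.finrank ℝ ((LinearMap.range (tmap 𝔤 Z a 1).toLinearMap).map
          (ρ g).toLinearMap) := by
          refine Submodule.finrank_mono ?_
          rintro _ ⟨v, rfl⟩
          exact ⟨_, ⟨tmap 𝔤 𝔤 b u v, rfl⟩, rfl⟩
      _ ≤ _ := Submodule.finrank_map_le _ _
  have hmain := eventually_eq_of_comp_eq_of_finrank_le hfc P (hder ▸ hs) hrank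
  have hec : Tendsto e (𝓝 1) (𝓝 u₀) := continuousAt_extChartAt (I := 𝓘(ℝ, 𝔤)) (1 : G)
  filter_upwards [hec.eventually hmain, heq] with g h1 h2 h3
  have h4 : f (e g) = a g := congrArg a h2
  have h5 : f u₀ = a 1 := congrArg a (e.left_inv (mem_extChartAt_source (1 : G)))
  rw [h4, h5] at h1
  exact h1 h3

/-- A smooth orbit map `a : G → Z` of a linear action meets the affine space `a 1 + B` only at
`a 1`, near `1`, if the subspace `B` meets the range of the derivative of `a` only at `0`. -/
theorem eventually_eq_one_of_sub_mem {a : G → Z} (ha : ContMDiff 𝓘(ℝ, 𝔤) 𝓘(ℝ, Z) ∞ a)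
    (ρ : G → Z →L[ℝ] Z) (hρ : ∀ g k, a (g * k) = ρ g (a k)) {B : Submodule ℝ Z}
    (hB : Disjoint (LinearMap.range (tmap 𝔤 Z a 1).toLinearMap) B) :
    ∀ᶠ g in 𝓝 (1 : G), a g - a 1 ∈ B → a g = a 1 := by
  -- The projection `P` onto the tangent range is taken along a complement `C` that contains `B`, so
  -- `P` cannot distinguish points of `a 1 + B`.
  obtain ⟨C, hBC, hC⟩ := hB.symm.exists_isCompl
  set P := ((LinearMap.range (tmap 𝔤 Z a 1).toLinearMap).projectionOnto C
    hC.symm).toContinuousLinearMap with hP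
  have hs : Function.Surjective (P.comp (tmap 𝔤 Z a 1)) := by
    rintro ⟨_, ξ, rfl⟩
    exact ⟨ξ, Submodule.projectionOnto_apply_of_mem_left hC.symm ⟨ξ, rfl⟩⟩
  filter_upwards [eventually_eq_one_of_comp_eq ha ρ hρ P hs le_rfl] with g h1 h2
  refine h1 (sub_eq_zero.1 ?_)
  rw [← map_sub]
  exact Submodule.projectionOnto_apply_of_mem_right hC.symm (hBC h2)

/-- The adjoint action depends continuously on the group element. -/
theorem continuous_Ad : Continuous fun g : G => Ad 𝔤 g := by
  have : IsManifold 𝓘(ℝ, 𝔤) ∞ G := inferInstance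
  refine continuous_clm_apply.2 fun ξ => continuous_iff_continuousAt.2 fun g₀ => ?_
  have h1 : ContMDiffAt (𝓘(ℝ, 𝔤).prod 𝓘(ℝ, 𝔤)) 𝓘(ℝ, 𝔤) ∞
      (Function.uncurry fun (g h : G) => g * h * g⁻¹) (g₀, 1) :=
    ((contMDiff_fst.mul contMDiff_snd).mul contMDiff_fst.inv).contMDiffAt
  have h3 := ContMDiffAt.mfderiv_apply (m := 1) (x₀ := g₀)
    (fun (g h : G) => g * h * g⁻¹) (fun _ => 1) id (fun _ => ξ) h1
    contMDiffAt_const contMDiffAt_id contMDiffAt_const (by decide)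
  -- Conjugation fixes `1`, so all base points are `1`, and the coordinate changes are from the
  -- chart at `1` to itself, hence trivial.
  have h5 : (fun g : G => Ad 𝔤 g ξ)
      = fun g : G => inTangentCoordinates 𝓘(ℝ, 𝔤) 𝓘(ℝ, 𝔤) (fun _ : G => (1 : G))
        (fun g : G => g * 1 * g⁻¹)
        (fun g : G => Ad 𝔤 g) g₀ g ξ := by
    funext g
    have k : ∀ g : G, g * 1 * g⁻¹ = 1 := by simp
    simp only [k]
    have h7 := inTangentCoordinates_eq (I := 𝓘(ℝ, 𝔤)) (I' := 𝓘(ℝ, 𝔤)) (x₀ := g₀) (x := g)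
      (fun _ => (1 : G)) (fun _ => (1 : G)) (fun g => Ad 𝔤 g)
      (mem_chart_source 𝔤 (1 : G)) (mem_chart_source 𝔤 (1 : G))
    refine Eq.trans ?_ (congrArg (fun f : 𝔤 →L[ℝ] 𝔤 => f ξ) h7).symm
    have h6 : ∀ v, (tangentBundleCore 𝓘(ℝ, 𝔤) G).coordChange (achart 𝔤 1) (achart 𝔤 1) 1 v = v :=
      fun v => tangentCoordChange_self (I := 𝓘(ℝ, 𝔤)) (x := 1) (z := 1) (v := v)
        (mem_extChartAt_source 1)
    simp only [ContinuousLinearMap.comp_apply]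
    rw [h6, h6]
  rw [h5]
  exact h3.continuousAt

theorem continuous_coAd :
    Continuous fun p : G × StrongDual ℝ 𝔤 => coAd p.1 p.2 := by
  have : IsTopologicalGroup G := topologicalGroup_of_lieGroup 𝓘(ℝ, 𝔤) ∞
  exact continuous_snd.clm_comp (continuous_Ad.comp continuous_fst.inv)

/-- Nearby points of a locally closed coadjoint orbit are translates by group elements near `1`. -/
theorem exists_coAd_eq_of_isLocallyClosed [T2Space G] [SecondCountableTopology G]
    {α : StrongDual ℝ 𝔤} (hα : IsLocallyClosed (coadjointOrbit G α)) {N : Set G}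
    (hN : N ∈ 𝓝 1) :
    ∃ W : Set (StrongDual ℝ 𝔤), IsOpen W ∧ α ∈ W ∧
      ∀ β ∈ W ∩ coadjointOrbit G α, ∃ g ∈ N, coAd g α = β := by
  have : IsTopologicalGroup G := topologicalGroup_of_lieGroup 𝓘(ℝ, 𝔤) ∞
  have : LocallyCompactSpace G := Manifold.locallyCompact_of_finiteDimensional 𝓘(ℝ, 𝔤)
  have : LocallyCompactSpace (StrongDual ℝ 𝔤) :=
    have : ProperSpace (StrongDual ℝ 𝔤) := FiniteDimensional.proper ℝ _
    inferInstance
  have : LocallyCompactSpace (coadjointOrbit G α) := hα.locallyCompactSpace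
  let _ : MulAction G (coadjointOrbit G α) :=
    { smul := fun g β => ⟨coAd g β.1, by
        obtain ⟨h, hh⟩ := β.2
        exact ⟨g * h, by rw [← hh]; exact coAd_mul g h α⟩⟩
      one_smul := fun β => Subtype.ext (coAd_one β.1)
      mul_smul := fun g h β => Subtype.ext (coAd_mul g h β.1) }
  have hsm : ∀ (g : G) (β : coadjointOrbit G α), (g • β).1 = coAd g β.1 := fun _ _ => rfl
  have : ContinuousSMul G (coadjointOrbit G α) :=
    ⟨(continuous_coAd.comp
      (continuous_fst.prodMk (continuous_subtype_val.comp continuous_snd))).subtype_mk _⟩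
  have : MulAction.IsPretransitive G (coadjointOrbit G α) := by
    refine ⟨?_⟩
    rintro ⟨_, g, rfl⟩ ⟨_, h, rfl⟩
    refine ⟨h * g⁻¹, Subtype.ext ?_⟩
    rw [hsm]
    simp only [← coAd_mul, inv_mul_cancel_right]
  let p : coadjointOrbit G α := ⟨α, 1, coAd_one α⟩
  -- Open mapping theorem for a transitive action: `G` is σ-compact, being locally compact and
  -- second countable, and the orbit is Baire, being locally closed in a locally compact space. Thus
  -- `N · α` is a neighbourhood of `α` in the orbit.
  have h1 := smul_singleton_mem_nhds_of_sigmaCompact hN p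
  obtain ⟨W, hW, hpW, hWo⟩ := mem_nhds_iff.1 h1
  obtain ⟨W', hW', rfl⟩ := isOpen_induced_iff.1 hpW
  refine ⟨W', hW', hWo, ?_⟩
  rintro β ⟨hβ, hβo⟩
  obtain ⟨g, hg, q, hq, h⟩ := hW (show (⟨β, hβo⟩ : coadjointOrbit G α) ∈ Subtype.val ⁻¹' W' from hβ)
  rw [Set.mem_singleton_iff.1 hq] at h
  exact ⟨g, hg, congrArg Subtype.val h⟩

end Equivariant

/-! ### The derivative of the coadjoint orbit map -/

section Model

variable {𝔤 : Type*} [NormedAddCommGroup 𝔤] [NormedSpace ℝ 𝔤]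
  {G : Type*} [TopologicalSpace G] [ChartedSpace 𝔤 G] [Group G] [LieGroup 𝓘(ℝ, 𝔤) ∞ G]
  {E : Type*} [NormedAddCommGroup E] [NormedSpace ℝ E]
  {M : Type*} [TopologicalSpace M] [ChartedSpace E M] [IsManifold 𝓘(ℝ, E) ∞ M]
  [MulAction G M] [ContMDiffSMul 𝓘(ℝ, 𝔤) 𝓘(ℝ, E) ∞ G M]

theorem contMDiff_orbitMap (x : M) : ContMDiff 𝓘(ℝ, 𝔤) 𝓘(ℝ, E) ∞ (fun g : G => g • x) :=
  (contMDiff_smul (I := 𝓘(ℝ, 𝔤)) (I' := 𝓘(ℝ, E)) (n := ∞) (G := G) (M := M)).comp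
    (contMDiff_id.prodMk contMDiff_const)

/-- The infinitesimal isotropy representation is linear in the tangent vector. -/
theorem isLinearMap_isotropyInf (x : M) (ξ : 𝔤) :
    IsLinearMap ℝ fun v : E => isotropyInf 𝔤 G E x v ξ := by
  constructor
  · intro v w
    have h := ((diffAt_isotropyInf (𝔤 := 𝔤) (G := G) x v).hasMFDerivAt.add
      (diffAt_isotropyInf (𝔤 := 𝔤) (G := G) x w).hasMFDerivAt).mfderiv
    have e : (fun g : G => tmap E E (fun m : M => extChartAt 𝓘(ℝ, E) x (g • m)) x (v + w))
      = (fun g : G => tmap E E (fun m : M => extChartAt 𝓘(ℝ, E) x (g • m)) x v)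
        + fun g : G => tmap E E (fun m : M => extChartAt 𝓘(ℝ, E) x (g • m)) x w := by
      funext g
      exact map_add _ v w
    rw [isotropyInf, e]
    exact congrArg (fun f : 𝔤 →L[ℝ] E => f ξ) h
  · intro c v
    have h := ((diffAt_isotropyInf (𝔤 := 𝔤) (G := G) x v).hasMFDerivAt.const_smul c).mfderiv
    have e : (fun g : G => tmap E E (fun m : M => extChartAt 𝓘(ℝ, E) x (g • m)) x (c • v))
      = c • fun g : G => tmap E E (fun m : M => extChartAt 𝓘(ℝ, E) x (g • m)) x v := by
      funext g
      exact map_smul _ c v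
    rw [isotropyInf, e]
    exact congrArg (fun f : 𝔤 →L[ℝ] E => f ξ) h

namespace HamiltonianAction

variable (A : HamiltonianAction 𝔤 G E M) (x : M)

/-- By equivariance this map is `g ↦ g · α`. Written through the momentum map it inherits smoothness
from `F` and from the action on `M`. -/
theorem contMDiff_momentum_orbitMap :
    ContMDiff 𝓘(ℝ, 𝔤) 𝓘(ℝ, StrongDual ℝ 𝔤) ∞ fun g : G => A.momentum (g • x) :=
  A.momentum_smooth.comp (contMDiff_orbitMap x)

theorem diffAt_momentum_orbitMap (g : G) :
    DiffAt 𝔤 (StrongDual ℝ 𝔤) (fun g : G => A.momentum (g • x)) g :=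
  (A.contMDiff_momentum_orbitMap x).contMDiffAt.mdifferentiableAt (by simp)

/-- The chain rule and the momentum equation for `η`, evaluated on `ξ_M(x)`; this expresses the
tangent space of the coadjoint orbit through `ω`. -/
theorem tmap_momentum_orbitMap (ξ η : 𝔤) :
    tmap 𝔤 (StrongDual ℝ 𝔤) (fun g : G => A.momentum (g • x)) 1 ξ η
      = A.form x ![inducedField 𝔤 G E x η, inducedField 𝔤 G E x ξ] := by
  have h1 : DiffAt E (StrongDual ℝ 𝔤) A.momentum x :=
    A.momentum_smooth.contMDiffAt.mdifferentiableAt (by simp)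
  have h2 : DiffAt 𝔤 E (fun g : G => g • x) 1 :=
    (contMDiff_orbitMap x).contMDiffAt.mdifferentiableAt (by simp)
  rw [tmap_comp_apply (g := A.momentum) (f := fun g : G => g • x) (one_smul G x) h1 h2]
  exact A.momentum_eq x η _

/-- The derivative of the orbit map of `α = F x` is antisymmetric as a bilinear form on `𝔤`. -/
theorem tmap_momentum_orbitMap_swap (ξ η : 𝔤) :
    tmap 𝔤 (StrongDual ℝ 𝔤) (fun g : G => A.momentum (g • x)) 1 ξ η
      = -tmap 𝔤 (StrongDual ℝ 𝔤) (fun g : G => A.momentum (g • x)) 1 η ξ := by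
  rw [tmap_momentum_orbitMap, tmap_momentum_orbitMap]
  have h := (A.form x).toAlternatingMap.map_swap
    ![inducedField 𝔤 G E x ξ, inducedField 𝔤 G E x η] (i := 0) (j := 1) (by decide)
  have e : (![inducedField 𝔤 G E x ξ, inducedField 𝔤 G E x η] ∘ Equiv.swap (0 : Fin 2) 1)
      = ![inducedField 𝔤 G E x η, inducedField 𝔤 G E x ξ] := by
    funext i
    fin_cases i <;> simp
  rw [e] at h
  exact h

/-- A curve in `G_α` with velocity `η` does not move `α`. -/
theorem tmap_momentum_orbitMap_eq_zero {η : 𝔤} (hη : η ∈ A.momentumIsotropyAlgebra x) :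
    tmap 𝔤 (StrongDual ℝ 𝔤) (fun g : G => A.momentum (g • x)) 1 η = 0 := by
  obtain ⟨γ, h0, h1, h2, h3⟩ := hη
  have e : (fun t => A.momentum (γ t • x)) = fun _ => A.momentum x := by
    funext t
    rw [A.equivariant]
    exact h1 t
  have h4 := tmap_comp_apply (g := fun g : G => A.momentum (g • x)) (f := γ) h0
    (A.diffAt_momentum_orbitMap x 1) h2 1
  rw [h3] at h4
  rw [← h4, e, tmap_const]
  rfl

/-! ### The affine slice `α + 𝔰°` and the images of `j` and `i` -/

namespace Splitting

variable {A x} (S : A.Splitting x)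

/-- The annihilator of `𝔰` in `𝔤*`. -/
def slice : Submodule ℝ (StrongDual ℝ 𝔤) where
  carrier := {β | ∀ ξ ∈ S.s, β ξ = 0}
  zero_mem' := fun _ _ => rfl
  add_mem' := fun ha hb ξ hξ => by
    rw [add_apply, ha ξ hξ, hb ξ hξ, add_zero]
  smul_mem' := fun c a ha ξ hξ => by
    rw [smul_apply, ha ξ hξ, smul_zero]

/-- The annihilator of `𝔰` is transverse to the tangent space of the coadjoint orbit. -/
theorem disjoint_range_slice :
    Disjoint (LinearMap.range
      (tmap 𝔤 (StrongDual ℝ 𝔤) (fun g : G => A.momentum (g • x)) 1).toLinearMap) S.slice := by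
  rw [Submodule.disjoint_def]
  rintro _ ⟨ξ, rfl⟩ h
  refine ContinuousLinearMap.ext fun ζ => ?_
  obtain ⟨η, hη, σ, hσ, rfl⟩ : ∃ a ∈ A.momentumIsotropyAlgebra x, ∃ b ∈ S.s, a + b = ζ :=
    Submodule.mem_sup.1 (S.isCompl_s.sup_eq_top ▸ Submodule.mem_top)
  -- Every tangent vector of the orbit annihilates `𝔤_α`: swapping the arguments moves `η` into the
  -- direction of differentiation, where it gives zero.
  have h1 : tmap 𝔤 (StrongDual ℝ 𝔤) (fun g : G => A.momentum (g • x)) 1 ξ η = 0 := by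
    rw [A.tmap_momentum_orbitMap_swap, A.tmap_momentum_orbitMap_eq_zero x hη]
    simp
  have h2 : tmap 𝔤 (StrongDual ℝ 𝔤) (fun g : G => A.momentum (g • x)) 1 ξ σ = 0 := h σ hσ
  change tmap 𝔤 (StrongDual ℝ 𝔤) (fun g : G => A.momentum (g • x)) 1 ξ (η + σ) = 0
  rw [map_add, h1, h2, add_zero]

variable [FiniteDimensional ℝ 𝔤]

/-- A locally closed coadjoint orbit through `α` meets `α + 𝔰°` only at `α`, near `α`. -/
theorem exists_slice_nhd [T2Space G] [SecondCountableTopology G]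
    (hα : IsLocallyClosed (coadjointOrbit G (A.momentum x))) :
    ∃ W : Set (StrongDual ℝ 𝔤), IsOpen W ∧ A.momentum x ∈ W ∧
      ∀ β ∈ S.slice, A.momentum x + β ∈ W → A.momentum x + β ∈ coadjointOrbit G (A.momentum x) →
        β = 0 := by
  have h1 := eventually_eq_one_of_sub_mem (A.contMDiff_momentum_orbitMap x)
    -- This is the coadjoint action of `g`, as a continuous linear map of `𝔤*`.
    (fun g => (ContinuousLinearMap.compL ℝ 𝔤 𝔤 ℝ).flip (Ad 𝔤 g⁻¹))
    (fun g k => by rw [mul_smul, A.equivariant]; rfl) S.disjoint_range_slice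
  obtain ⟨W, hW, hαW, h2⟩ := exists_coAd_eq_of_isLocallyClosed hα h1
  refine ⟨W, hW, hαW, fun β hβ hβW hβO => ?_⟩
  obtain ⟨g, hg, hgβ⟩ := h2 _ ⟨hβW, hβO⟩
  have h3 : A.momentum (g • x) = A.momentum x + β := (A.equivariant g x).trans hgβ
  have h4 : A.momentum ((1 : G) • x) = A.momentum x := by rw [one_smul]
  have h5 := hg (by rw [h3, h4, add_sub_cancel_left]; exact hβ)
  rw [h3, h4] at h5
  exact add_eq_left.1 h5

theorem j_mem_slice (l : StrongDual ℝ (A.IsotropyQuotient x)) : S.j l ∈ S.slice := by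
  intro ξ hξ
  have h : S.projAlpha ξ = 0 := Submodule.projectionOnto_apply_of_mem_right S.isCompl_s hξ
  change l (Submodule.Quotient.mk (S.projAlpha ξ)) = 0
  rw [h, Submodule.Quotient.mk_zero, map_zero]

theorem i_mem_slice (ν : StrongDual ℝ (isotropyAlgebra 𝔤 G x)) : S.i ν ∈ S.slice := by
  intro ξ hξ
  have h : S.projIso ξ = 0 := Submodule.projectionOnto_apply_of_mem_right S.isCompl_sup
    (Submodule.mem_sup_right hξ)
  change ν (S.projIso ξ) = 0
  rw [h, map_zero]

theorem j_zero : S.j 0 = 0 := rfl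

theorem i_zero : S.i 0 = 0 := rfl

/-- The images of `j` and `i` are independent, and `j` and `i` are injective. -/
theorem eq_zero_of_j_add_i_eq_zero {l : StrongDual ℝ (A.IsotropyQuotient x)}
    {ν : StrongDual ℝ (isotropyAlgebra 𝔤 G x)} (h : S.j l + S.i ν = 0) : l = 0 ∧ ν = 0 := by
  -- Elements of `𝔤_x` have class zero in `𝔤_α / 𝔤_x`, so evaluation on them sees only `ν`. Once `ν
  -- = 0`, evaluation on `𝔤_α` recovers `l`.
  have hν : ν = 0 := by
    ext ξ
    have hξ : ξ.1 ∈ A.momentumIsotropyAlgebra x := S.sup_m ▸ Submodule.mem_sup_left ξ.2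
    have h1 : S.projAlpha ξ.1 = ⟨ξ.1, hξ⟩ :=
      Submodule.projectionOnto_apply_of_mem_left S.isCompl_s hξ
    have h2 : S.projIso ξ.1 = ξ := Submodule.projectionOnto_apply_of_mem_left S.isCompl_sup ξ.2
    have h3 : l (Submodule.Quotient.mk (S.projAlpha ξ.1)) + ν (S.projIso ξ.1) = 0 :=
      congrArg (fun f : StrongDual ℝ 𝔤 => f ξ.1) h
    have h4 : (Submodule.Quotient.mk ⟨ξ.1, hξ⟩ : A.IsotropyQuotient x) = 0 :=
      (Submodule.Quotient.mk_eq_zero _).2 ξ.2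
    rw [h1, h2, h4, map_zero, zero_add] at h3
    exact h3
  refine ⟨?_, hν⟩
  rw [hν, i_zero, add_zero] at h
  ext q
  obtain ⟨ξ, rfl⟩ := Submodule.Quotient.mk_surjective _ q
  have h1 : S.projAlpha ξ.1 = ξ := Submodule.projectionOnto_apply_of_mem_left S.isCompl_s ξ.2
  have h2 : l (Submodule.Quotient.mk (S.projAlpha ξ.1)) = 0 :=
    congrArg (fun f : StrongDual ℝ 𝔤 => f ξ.1) h
  rw [h1] at h2
  exact h2

variable [FiniteDimensional ℝ E]

/-- For fixed `ξ` the vector `ξ · v` is linear in `v`, hence continuous in finite dimension, and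
`ω_x` is continuous. -/
theorem continuous_FV : Continuous S.FV := by
  refine continuous_clm_apply.2 fun ξ => ?_
  have h1 : Continuous fun v : S.V => isotropyInf 𝔤 G E x v.1 ξ.1 :=
    (LinearMap.continuous_of_finiteDimensional
      (isLinearMap_isotropyInf (G := G) x ξ.1).mk').comp continuous_subtype_val
  have h2 : Continuous fun v : S.V => ![isotropyInf 𝔤 G E x v.1 ξ.1, v.1] :=
    h1.matrixVecCons (continuous_subtype_val.matrixVecCons continuous_const)
  exact continuous_const.mul ((A.form x).cont.comp h2)

/-- The momentum map `F_Y` on the fibre over the base point, before the translation by `G`. -/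
theorem continuous_fibreMomentum :
    Continuous fun p : StrongDual ℝ (A.IsotropyQuotient x) × S.V =>
      A.momentum x + S.j p.1 + S.i (S.FV p.2) := by
  have h1 : Continuous S.j := continuous_id.clm_comp continuous_const
  have h2 : Continuous S.i := continuous_id.clm_comp continuous_const
  exact (continuous_const.add (h1.comp continuous_fst)).add
    (h2.comp (S.continuous_FV.comp continuous_snd))

theorem FV_zero : S.FV 0 = 0 := by
  ext ξ
  rw [FV_apply]
  have h : A.form x ![isotropyInf 𝔤 G E x (0 : S.V).1 ξ.1, (0 : S.V).1] = 0 :=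
    (A.form x).map_coord_zero 1 rfl
  rw [h, mul_zero]
  rfl

/-! ### The neighbourhood `Y₀` of the zero section -/

/-- The set of all classes `[g, λ, v]` with `α + j(λ) + i(F_V(v)) ∈ W`. -/
def tube (W : Set (StrongDual ℝ 𝔤)) : Set S.Model :=
  {y | ∃ g l v, y = S.cls g l v ∧ A.momentum x + S.j l + S.i (S.FV v) ∈ W}

/-- Since `G_x` fixes `α`, the fibre momentum inherits the equivariance of `j`, `i` and `F_V`. This
describes how it changes with the representative of a class. -/
theorem coAd_fibreMomentum (h : MulAction.stabilizer G x)
    (l : StrongDual ℝ (A.IsotropyQuotient x)) (v : S.V) :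
    A.momentum x + S.j (A.dualAct x h l) + S.i (S.FV (S.VAct h v))
      = coAd h.1 (A.momentum x + S.j l + S.i (S.FV v)) := by
  have h1 : coAd h.1 (A.momentum x) = A.momentum x := A.stabilizer_le x h.2
  rw [S.j_dualAct, S.i_FV_VAct]
  conv_lhs => rw [← h1]
  rfl

theorem isOpen_tube {W : Set (StrongDual ℝ 𝔤)} (hW : IsOpen W) : IsOpen (S.tube W) := by
  -- The set `W` need not be `G_x`-invariant, so a class belongs to the tube when some
  -- representative has fibre momentum in `W`; hence the union over `G_x`.
  have e : Quotient.mk S.modelSetoid ⁻¹' S.tube W = ⋃ h : MulAction.stabilizer G x,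
      {p | coAd h.1 (A.momentum x + S.j p.2.1 + S.i (S.FV p.2.2)) ∈ W} := by
    ext p
    rw [Set.mem_iUnion]
    constructor
    · rintro ⟨g, l, v, h1, h2⟩
      obtain ⟨h, h3⟩ := Quotient.exact h1
      refine ⟨h, ?_⟩
      obtain ⟨-, rfl, rfl⟩ : g = p.1 * h.1⁻¹ ∧ l = A.dualAct x h p.2.1 ∧ v = S.VAct h p.2.2 := by
        simpa using h3
      rwa [coAd_fibreMomentum] at h2
    · rintro ⟨h, hh⟩
      exact ⟨p.1 * h.1⁻¹, A.dualAct x h p.2.1, S.VAct h p.2.2, Quotient.sound ⟨h, rfl⟩, by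
        rwa [coAd_fibreMomentum]⟩
  refine isOpen_coinduced.2 ?_
  change IsOpen (Quotient.mk S.modelSetoid ⁻¹' S.tube W)
  rw [e]
  refine isOpen_iUnion fun h => hW.preimage ?_
  have h1 : Continuous fun β : StrongDual ℝ 𝔤 => coAd h.1 β :=
    continuous_id.clm_comp continuous_const
  exact h1.comp (S.continuous_fibreMomentum.comp continuous_snd)

end Splitting
end HamiltonianAction
end Model
end HamiltonianModel

/-! ### The zero level near the zero section -/

theorem mainTheorem6
    {𝔤 : Type*} [NormedAddCommGroup 𝔤] [NormedSpace ℝ 𝔤] [FiniteDimensional ℝ 𝔤]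
    {G : Type*} [TopologicalSpace G] [T2Space G] [SecondCountableTopology G]
    [ChartedSpace 𝔤 G] [Group G] [LieGroup 𝓘(ℝ, 𝔤) ∞ G]
    {E : Type*} [NormedAddCommGroup E] [NormedSpace ℝ E] [FiniteDimensional ℝ E]
    {M : Type*} [TopologicalSpace M] [T2Space M] [ParacompactSpace M]
    [ChartedSpace E M] [IsManifold 𝓘(ℝ, E) ∞ M]
    [MulAction G M] [ContMDiffSMul 𝓘(ℝ, 𝔤) 𝓘(ℝ, E) ∞ G M] [ProperSMul G M]
    (A : HamiltonianModel.HamiltonianAction 𝔤 G E M) (x : M)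
    (hα : IsLocallyClosed (HamiltonianModel.coadjointOrbit G (A.momentum x)))
    (S : A.Splitting x) :
    ∃ Y₀ : Set S.Model, IsOpen Y₀ ∧ S.zeroSection ⊆ Y₀ ∧
      S.FY ⁻¹' HamiltonianModel.coadjointOrbit G (A.momentum x) ∩ Y₀ =
        {y | y ∈ Y₀ ∧ ∃ g l v, y = S.cls g l v ∧ l = 0 ∧ S.FV v = 0} := by
  obtain ⟨W, hW, hαW, h⟩ := S.exists_slice_nhd hα
  refine ⟨S.tube W, S.isOpen_tube hW, ?_, ?_⟩
  · rintro _ ⟨g, rfl⟩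
    exact ⟨g, 0, 0, rfl, by rwa [S.FV_zero, S.j_zero, S.i_zero, add_zero, add_zero]⟩
  · ext y
    constructor
    · rintro ⟨⟨k, hk⟩, hy⟩
      refine ⟨hy, ?_⟩
      -- The representative comes from membership in the tube, so its fibre momentum is in `W`;
      -- translating by `g⁻¹` then places that fibre momentum on the orbit.
      obtain ⟨g, l, v, rfl, hlv⟩ := hy
      have h1 : A.momentum x + (S.j l + S.i (S.FV v)) = HamiltonianModel.coAd (g⁻¹ * k)
          (A.momentum x) := by
        have h2 : HamiltonianModel.coAd k (A.momentum x)
            = HamiltonianModel.coAd g (A.momentum x + S.j l + S.i (S.FV v)) := hk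
        rw [HamiltonianModel.coAd_mul, h2, ← HamiltonianModel.coAd_mul, inv_mul_cancel,
          HamiltonianModel.coAd_one, add_assoc]
      rw [add_assoc] at hlv
      have h3 := h _ (S.slice.add_mem (S.j_mem_slice l) (S.i_mem_slice _)) hlv ⟨_, h1.symm⟩
      exact ⟨g, l, v, rfl, S.eq_zero_of_j_add_i_eq_zero h3⟩
    -- This inclusion is not local: wherever `λ` and `F_V(v)` vanish, the value of `F_Y` is `g · α`.
    · rintro ⟨hy, g, l, v, rfl, rfl, hv⟩
      refine ⟨⟨g, ?_⟩, hy⟩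
      rw [S.FY_cls, hv, S.j_zero, S.i_zero, add_zero, add_zero]
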